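/- Let $K$ be an infinite field, let $R = K[x_1,\dots,x_n]$ be a polynomial ring in finitely many variables, and let $I \subseteq R$ be an ideal that can be generated by at most two elements, i.e. $\mu(I) \le 2$, where $\mu(I)$ is the minimal number of generators of $I$. Then $I$ is basic: if $J \subseteq I$ is an ideal with $J I^m = I^{m+1}$ for some integer $m > 0$ (that is, $J$ is a reduction of $I$), then $J = I$. -/

import Mathlib

/-- An ideal `J ⊆ I` is a reduction of `I` if `J I ^ n = I ^ (n + 1)` for some integer `n > 0`. -/
def Ideal.IsReduction {R : Type*} [CommRing R] (J I : Ideal R) : Prop :=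
  J ≤ I ∧ ∃ n : ℕ, 0 < n ∧ J * I ^ n = I ^ (n + 1)

/-- An ideal is basic if it has no reductions other than itself. -/
def Ideal.IsBasic {R : Type*} [CommRing R] (I : Ideal R) : Prop :=
  ∀ J : Ideal R, J.IsReduction I → J = I

/-! Cancelling a gcd reduces to coprime `f, g`. Forms vanishing at `(f, g)` then have coefficients
in every prime `M` containing `f, g`, so a linear form mod `M` that kills a reduction `J` is zero.
If `J ≠ I`, take `M` maximal over `J : I`; Cramer's rule makes the coefficient vectors of `J`
pairwise dependent mod `M`, which yields a nonzero such form. -/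

section BasicIdeals

variable {R : Type*} [CommRing R]

/-- If `f, g` lie in `M`, a homogeneous relation between `f` and `g` (a regular sequence) has
coefficients in `M`; here forms `F` are encoded by the pairs `(F (f, g), F (p, q))`. -/
theorem snd_mem_of_mem_span_pair_pow [IsDomain R] {M : Ideal R} {f g : R}
    (hf : f ∈ M) (hg : g ∈ M) (hg0 : g ≠ 0)
    (hdvd : ∀ (k : ℕ) (c : R), g ∣ c * f ^ k → g ∣ c) (p q : R) (k : ℕ) :
    ∀ b : R, ((0, b) : R × R) ∈ Submodule.span R {((f, p) : R × R), (g, q)} ^ k → b ∈ M := by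
  set L : Submodule R (R × R) := Submodule.span R {((f, p) : R × R), (g, q)} with hL
  have hfL : ((f, p) : R × R) ∈ L := Submodule.subset_span (by simp)
  -- Division of forms: `F = c X ^ (k + 1) + Y G`.
  have hdecomp : ∀ (k : ℕ) (x : R × R), x ∈ L ^ (k + 1) →
      ∃ c : R, ∃ z ∈ L ^ k, x = c • (f, p) ^ (k + 1) + (g, q) * z := by
    intro k
    induction k with
    | zero =>
      intro x hx
      rw [zero_add, pow_one, hL, Submodule.mem_span_pair] at hx
      obtain ⟨a, b, rfl⟩ := hx
      exact ⟨a, b • 1, Submodule.smul_mem _ _ (by simp), by simp [mul_comm]⟩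
    | succ k ih =>
      intro x hx
      rw [pow_succ] at hx
      refine Submodule.mul_induction_on hx ?_ ?_
      · intro m hm l hl
        have hl' := hl
        rw [hL, Submodule.mem_span_pair] at hl'
        obtain ⟨a, b, rfl⟩ := hl'
        obtain ⟨c, z, hz, rfl⟩ := ih m hm
        refine ⟨c * a, z * (a • (f, p)) + b • (c • (f, p) ^ (k + 1) + (g, q) * z), ?_, ?_⟩
        · refine Submodule.add_mem _ ?_ (Submodule.smul_mem _ _ hm)
          rw [pow_succ]
          exact Submodule.mul_mem_mul hz (Submodule.smul_mem _ _ hfL)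
        · ext <;> simp <;> ring
      · rintro x y ⟨c, z, hz, rfl⟩ ⟨d, w, hw, rfl⟩
        refine ⟨c + d, z + w, Submodule.add_mem _ hz hw, ?_⟩
        rw [add_smul, mul_add]
        abel
  induction k with
  | zero =>
    intro b hb
    rw [pow_zero, Submodule.mem_one] at hb
    obtain ⟨y, hy⟩ := hb
    simp only [Prod.algebraMap_apply, Algebra.algebraMap_self, RingHom.id_apply,
      Prod.mk.injEq] at hy
    rw [← hy.2, hy.1]
    exact M.zero_mem
  | succ k ih =>
    intro b hb
    obtain ⟨c, z, hz, h⟩ := hdecomp k _ hb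
    obtain ⟨z₁, z₂⟩ := z
    simp only [Prod.pow_mk, Prod.smul_mk, smul_eq_mul, Prod.mk_mul_mk, Prod.mk_add_mk,
      Prod.mk.injEq] at h
    obtain ⟨h₁, h₂⟩ := h
    obtain ⟨e, rfl⟩ := hdvd (k + 1) c ⟨-z₁, by linear_combination -h₁⟩
    have h₃ : e * f ^ (k + 1) + z₁ = 0 :=
      (mul_eq_zero.mp (show g * (e * f ^ (k + 1) + z₁) = 0 by
        linear_combination -h₁)).resolve_left hg0
    -- With `c = g e`, the form `G + e f X ^ k` of degree `k` vanishes at `(f, g)`.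
    have h₄ : z₂ + e * f * p ^ k ∈ M := by
      apply ih
      have : ((0, z₂ + e * f * p ^ k) : R × R) = (z₁, z₂) + (e * f) • (f, p) ^ k := by
        ext
        · simp only [Prod.pow_mk, Prod.smul_mk, smul_eq_mul, Prod.mk_add_mk]
          linear_combination -h₃
        · simp
      rw [this]
      exact Submodule.add_mem _ hz (Submodule.smul_mem _ _ (Submodule.pow_mem_pow _ hfL k))
    have h₅ : b = q * (z₂ + e * f * p ^ k) - q * e * p ^ k * f + e * p ^ (k + 1) * g := by
      rw [h₂]; ring
    rw [h₅]
    exact M.add_mem (M.sub_mem (M.mul_mem_left _ h₄) (M.mul_mem_left _ hf)) (M.mul_mem_left _ hg)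

theorem exists_mem_span_pair_pow (f g p q : R) (k : ℕ) (x : R)
    (hx : x ∈ (Ideal.span {f, g}) ^ k) :
    ∃ v : R, ((x, v) : R × R) ∈ Submodule.span R {((f, p) : R × R), (g, q)} ^ k := by
  induction k generalizing x with
  | zero => exact ⟨x, by rw [pow_zero, Submodule.mem_one]; exact ⟨x, rfl⟩⟩
  | succ k ih =>
    rw [pow_succ] at hx
    refine Submodule.mul_induction_on hx ?_ ?_
    · intro y hy l hl
      obtain ⟨v, hv⟩ := ih y hy
      obtain ⟨a, b, rfl⟩ := Ideal.mem_span_pair.mp hl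
      refine ⟨v * (a * p + b * q), ?_⟩
      rw [pow_succ, ← Prod.mk_mul_mk]
      exact Submodule.mul_mem_mul hv (Submodule.mem_span_pair.mpr ⟨a, b, by simp⟩)
    · rintro x y ⟨v, hv⟩ ⟨w, hw⟩
      exact ⟨v + w, Submodule.add_mem _ hv hw⟩

/-- If a linear form with coefficients `p, q` vanishes modulo `M` on all elements of a reduction
of `(f, g)`, then `p` and `q` vanish modulo `M`. -/
theorem Ideal.IsReduction.mem_of_forall_mem [IsDomain R] {M J : Ideal R} [M.IsPrime] {f g : R}
    (hf : f ∈ M) (hg : g ∈ M) (hg0 : g ≠ 0)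
    (hdvd : ∀ (k : ℕ) (c : R), g ∣ c * f ^ k → g ∣ c)
    (hJ : J.IsReduction (Ideal.span {f, g})) {p q : R}
    (hpq : ∀ a b : R, a * f + b * g ∈ J → a * p + b * q ∈ M) : p ∈ M ∧ q ∈ M := by
  obtain ⟨hle, m, -, hm⟩ := hJ
  set L : Submodule R (R × R) := Submodule.span R {((f, p) : R × R), (g, q)} with hL
  have hlift : ∀ x ∈ J * Ideal.span {f, g} ^ m, ∃ v ∈ M, ((x, v) : R × R) ∈ L ^ (m + 1) := by
    intro x hx
    refine Submodule.mul_induction_on hx ?_ ?_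
    · intro j hj y hy
      obtain ⟨a, b, rfl⟩ := Ideal.mem_span_pair.mp (hle hj)
      obtain ⟨v, hv⟩ := exists_mem_span_pair_pow f g p q m y hy
      refine ⟨(a * p + b * q) * v, M.mul_mem_right _ (hpq a b hj), ?_⟩
      rw [pow_succ', ← Prod.mk_mul_mk]
      exact Submodule.mul_mem_mul (Submodule.mem_span_pair.mpr ⟨a, b, by simp⟩) hv
    · rintro x y ⟨v, hvM, hv⟩ ⟨w, hwM, hw⟩
      exact ⟨v + w, M.add_mem hvM hwM, Submodule.add_mem _ hv hw⟩
  have key : ∀ x y : R, x ∈ Ideal.span {f, g} → ((x, y) : R × R) ∈ L → y ∈ M := by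
    intro x y hx hxy
    -- Two forms represent `x ^ (m + 1)`, with values `v` and `y ^ (m + 1)` at `(p, q)`; their
    -- difference vanishes at `(f, g)`.
    obtain ⟨v, hvM, hv⟩ := hlift (x ^ (m + 1)) (hm ▸ Ideal.pow_mem_pow hx _)
    have h : y ^ (m + 1) - v ∈ M := by
      refine snd_mem_of_mem_span_pair_pow hf hg hg0 hdvd p q (m + 1) (y ^ (m + 1) - v) ?_
      rw [← hL]
      have := Submodule.sub_mem _ (Submodule.pow_mem_pow L hxy (m + 1)) hv
      simpa using this
    exact Ideal.IsPrime.mem_of_pow_mem ‹_› _ ((M.sub_mem_iff_left hvM).mp h)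
  exact ⟨key f p (Ideal.subset_span (by simp)) (Submodule.subset_span (by simp)),
    key g q (Ideal.subset_span (by simp)) (Submodule.subset_span (by simp))⟩

/-- An ideal generated by two relatively prime elements of a UFD is basic. -/
theorem IsRelPrime.isBasic_span_pair [IsDomain R] [UniqueFactorizationMonoid R] {f g : R}
    (hfg : IsRelPrime f g) : (Ideal.span {f, g}).IsBasic := by
  intro J hJ
  obtain ⟨hle, m, -, hm⟩ := id hJ
  refine le_antisymm hle ?_
  have hcolon : J.colon (Ideal.span {f, g} : Set R) = ⊤ := by
    by_contra hne
    obtain ⟨M, hM, hcM⟩ := Ideal.exists_le_maximal _ hne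
    have hJM : J ≤ M := fun x hx => hcM <| Submodule.mem_colon.mpr
      fun y _ => J.mul_mem_right y hx
    have hIM : Ideal.span {f, g} ≤ M := by
      refine hM.isPrime.le_of_pow_le (n := m + 1) ?_
      rw [← hm]
      exact le_trans Ideal.mul_le_left hJM
    have hf : f ∈ M := hIM (Ideal.subset_span (by simp))
    have hg : g ∈ M := hIM (Ideal.subset_span (by simp))
    have hg0 : g ≠ 0 := by
      rintro rfl
      exact hM.ne_top (M.eq_top_of_isUnit_mem hf (isRelPrime_zero_right.mp hfg))
    have hdvd : ∀ (k : ℕ) (c : R), g ∣ c * f ^ k → g ∣ c := fun k c h =>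
      (hfg.symm.pow_right).dvd_of_dvd_mul_right h
    have hdet : ∀ a b c d : R, a * f + b * g ∈ J → c * f + d * g ∈ J → a * d - b * c ∈ M := by
      intro a b c d h₁ h₂
      refine hcM (Submodule.mem_colon.mpr fun y hy => ?_)
      obtain ⟨u, v, rfl⟩ := Ideal.mem_span_pair.mp hy
      have : (a * d - b * c) • (u * f + v * g) =
          (u * d - v * c) * (a * f + b * g) + (v * a - u * b) * (c * f + d * g) := by
        rw [smul_eq_mul]; ring
      rw [this]
      exact J.add_mem (J.mul_mem_left _ h₁) (J.mul_mem_left _ h₂)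
    -- By `hdet`, the linear form `(d, -c)` kills `J` mod `M`.
    have hcoeff : ∀ c d : R, c * f + d * g ∈ J → d ∈ M ∧ -c ∈ M := fun c d h =>
      hJ.mem_of_forall_mem hf hg hg0 hdvd fun a b h' => by
        simpa [sub_eq_add_neg] using hdet a b c d h' h
    refine hM.ne_top ((Ideal.eq_top_iff_one M).mpr ?_)
    -- All coefficients now lie in `M`, so the first coordinate kills `J` too, forcing `1 ∈ M`.
    refine (hJ.mem_of_forall_mem (p := 1) (q := 0) hf hg hg0 hdvd fun a b h => ?_).1
    simpa using (hcoeff a b h).2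
  intro y hy
  have h1 : (1 : R) ∈ J.colon (Ideal.span {f, g} : Set R) := hcolon ▸ Submodule.mem_top
  simpa using Submodule.mem_colon.mp h1 y hy

theorem Ideal.IsBasic.span_singleton_mul [IsDomain R] {I : Ideal R} (hI : I.IsBasic) {h : R}
    (h0 : h ≠ 0) : (Ideal.span {h} * I).IsBasic := by
  rintro J ⟨hle, m, hm0, hm⟩
  obtain ⟨J', rfl⟩ : ∃ J' : Ideal R, J = Ideal.span {h} * J' := by
    refine ⟨Submodule.comap (LinearMap.mulLeft R h) J, le_antisymm (fun x hx => ?_) ?_⟩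
    · obtain ⟨y, -, rfl⟩ := Ideal.mem_span_singleton_mul.mp (hle hx)
      exact Ideal.mem_span_singleton_mul.mpr ⟨y, hx, rfl⟩
    · exact Ideal.span_singleton_mul_le_iff.mpr fun y hy => hy
  congr 1
  refine hI J' ⟨(Ideal.span_singleton_mul_right_mono h0).mp hle, m, hm0, ?_⟩
  -- Both sides of the reduction equation carry the factor `h ^ (m + 1)`.
  refine (Ideal.span_singleton_mul_right_inj (pow_ne_zero (m + 1) h0)).mp ?_
  rw [← Ideal.span_singleton_pow, ← mul_pow, ← hm, mul_pow, pow_succ]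
  ring

/-- An ideal of a UFD that is generated by two elements is basic. -/
theorem Ideal.isBasic_span_pair [IsDomain R] [UniqueFactorizationMonoid R] (f g : R) :
    (Ideal.span {f, g}).IsBasic := by
  by_cases hf : f = 0
  · subst hf
    by_cases hg : g = 0
    · subst hg
      rintro J ⟨hle, -⟩
      have : Ideal.span {(0 : R), 0} = ⊥ := by simp
      rw [this] at hle ⊢
      exact le_bot_iff.mp hle
    · have := (isRelPrime_one_right (x := (0 : R))).isBasic_span_pair.span_singleton_mul hg
      simpa [Ideal.span_mul_span'] using this
  · obtain ⟨f', g', h, hrel, rfl, rfl⟩ := UniqueFactorizationMonoid.exists_reduced_factors f hf g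
    have := hrel.isBasic_span_pair.span_singleton_mul (left_ne_zero_of_mul hf)
    simpa [Ideal.span_mul_span', Set.singleton_mul, Set.image_pair] using this

end BasicIdeals

/-- Here `Submodule.spanFinrank I` is the minimal number of generators of `I` (which is finitely
generated, the ring being Noetherian). -/
theorem theorem4p1 {K : Type*} [Field K] [Infinite K] (n : ℕ)
    (I : Ideal (MvPolynomial (Fin n) K)) (hI : Submodule.spanFinrank I ≤ 2) :
    I.IsBasic := by
  have hfg : Submodule.FG I := IsNoetherian.noetherian I
  rcases hcard : I.generators.ncard with _ | _ | _ | k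
  · rw [Set.ncard_eq_zero hfg.finite_generators] at hcard
    have hbot : I = ⊥ := by rw [← I.span_generators, hcard, Submodule.span_empty]
    rw [hbot]
    simpa using Ideal.isBasic_span_pair (0 : MvPolynomial (Fin n) K) 0
  · obtain ⟨f, hf⟩ := Set.ncard_eq_one.mp hcard
    have := Ideal.isBasic_span_pair f f
    rwa [Set.pair_eq_singleton, ← hf, Ideal.span, I.span_generators] at this
  · obtain ⟨f, g, -, hf⟩ := Set.ncard_eq_two.mp hcard
    have := Ideal.isBasic_span_pair f g
    rwa [← hf, Ideal.span, I.span_generators] at this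
  · rw [hfg.generators_ncard] at hcard
    omega
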